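/- Let $A$ be a complex $m\times m$ matrix, $m\ge 1$, let $z_1,\dots,z_n\in\mathbb C$, $n\ge 1$, be arbitrary (possibly repetitive) points, and let $p$ be the interpolation polynomial of $f(z)=e^z$ with respect to $z_1,\dots,z_n$ taking multiplicities into account, i.e. the polynomial of degree less than $n$ such that $p^{(j)}(w)=e^{w}$ for every $w$ that occurs $r\ge1$ times among $z_1,\dots,z_n$ and all $0\le j<r$. Put $$\Omega(z)=\prod_{k=1}^n(z-z_k),\qquad \gamma=\max\Bigl\{\max_{\lambda\in\sigma(A)}\operatorname{Re}\lambda,\ \max_{1\le k\le n}\operatorname{Re}z_k\Bigr\},$$ where $\sigma(A)$ is the spectrum of $A$. Let $A=Q^{-1}(D+N)Q$ be any triangular Schur form of $A$, where $Q$ is unitary, $D$ is diagonal and $N$ is strictly (upper or lower) triangular. Then $$\lVert e^A-p(A)\rVert_{2\to2}\le e^{\gamma}\,\frac{\lVert\Omega(A)\rVert_{2\to2}}{n!}\,\sum_{j=0}^{m-1}\frac{\lVert N\rVert_{2\to2}^j}{j!},$$ where $\lVert\cdot\rVert_{2\to2}$ is the matrix norm induced by the Euclidean norm on $\mathbb C^m$.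 -/

import Mathlib

open Polynomial
open scoped Nat Matrix.Norms.L2Operator

/-- A matrix is strictly triangular if it is strictly upper triangular or strictly lower
triangular (zero diagonal included in both cases). -/
def IsStrictlyTriangular {m : ℕ} (N : Matrix (Fin m) (Fin m) ℂ) : Prop :=
  (∀ i j, j ≤ i → N i j = 0) ∨ (∀ i j, i ≤ j → N i j = 0)

/-- `p` is the (Hermite) interpolation polynomial of `f` with respect to the possibly repetitive
points `z 0, …, z (n - 1)`: it has degree less than `n`, and at every point `w` that occurs `r`
times among the `z k`, the derivatives of `p` and `f` of orders `0, …, r - 1` agree. -/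
def IsInterpolationPolynomial {n : ℕ} (f : ℂ → ℂ) (z : Fin n → ℂ) (p : ℂ[X]) : Prop :=
  p.degree < n ∧
    ∀ w : ℂ, ∀ j < {k : Fin n | z k = w}.ncard,
      (derivative^[j] p).eval w = iteratedDeriv j f w

/-- `Ω(x) = ∏ₖ (x - zₖ)`. -/
noncomputable def nodePolynomial {n : ℕ} (z : Fin n → ℂ) : ℂ[X] :=
  ∏ k, (X - C (z k))

/-- `α`: the largest real part of a point of the spectrum of `A`
(the spectrum is finite, and non-empty when the size is positive). -/
noncomputable def spectralAbscissa {m : ℕ} (A : Matrix (Fin m) (Fin m) ℂ) : ℝ :=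
  sSup (Complex.re '' spectrum ℂ A)

/-- `β`: the largest real part of an interpolation point. -/
noncomputable def nodeAbscissa {n : ℕ} (z : Fin n → ℂ) : ℝ :=
  ⨆ k, (z k).re

/-! ### Linear differential equations in a Banach algebra. -/

section Duhamel

variable {𝔸 : Type*} [NormedRing 𝔸] [NormedAlgebra ℂ 𝔸] [CompleteSpace 𝔸]

/-! Newton interpolation gives `e^A - p(A) = Ω(A) R`, where `R` is the divided difference of the
exponential at the nodes and `A`. Scaling to `x ↦ e^{tx}` makes divided differences solutions of
linear equations `y' = w y + h`: adding a node `w` is one convolution with `e^{tw}`. Hence repeated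
nodes need no limit, and the Newton identity follows from uniqueness for such equations
(`expRemainder_sub_eq_algebraMap`).

If `‖e^{tA}‖ ≤ K e^{tγ}` on `[0, 1]`, each of the `n` convolutions keeps the factor `e^{tγ}` and
integrates a power of `t`, so `‖R‖ ≤ K e^γ / n!` (`norm_expRemainder_le`). The constant `K = ∑ ‖N‖^j
/ j!` comes from the Dyson series of `e^{t(D+N)}`, which stops before order `m` because `N` is
strictly triangular. Uniqueness of Hermite interpolation identifies `p` with the Newton form
(`IsInterpolationPolynomial.eq_expNewton`). -/

theorem continuous_exp_smul (a : 𝔸) : Continuous fun t : ℝ => NormedSpace.exp (t • a) :=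
  continuous_iff_continuousAt.2 fun t => (hasDerivAt_exp_smul_const a t).continuousAt

theorem exp_add_smul (a : 𝔸) (s t : ℝ) :
    NormedSpace.exp ((s + t) • a) = NormedSpace.exp (s • a) * NormedSpace.exp (t • a) := by
  let : NormedAlgebra ℚ 𝔸 := NormedAlgebra.restrictScalars ℚ ℂ 𝔸
  rw [add_smul]
  exact NormedSpace.exp_add_of_commute (((Commute.refl a).smul_left s).smul_right t)

theorem exp_smul_mul_exp_neg_smul (a : 𝔸) (t : ℝ) :
    NormedSpace.exp (t • a) * NormedSpace.exp (-t • a) = 1 := by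
  rw [← exp_add_smul]
  simp [NormedSpace.exp_zero]

/-- The solution of `y' = a y + h`, `y 0 = 0`. -/
noncomputable def duhamel (a : 𝔸) (h : ℝ → 𝔸) (t : ℝ) : 𝔸 :=
  NormedSpace.exp (t • a) * ∫ s in (0 : ℝ)..t, NormedSpace.exp (-s • a) * h s

@[simp] theorem duhamel_zero (a : 𝔸) (h : ℝ → 𝔸) : duhamel a h 0 = 0 := by
  simp [duhamel]

theorem hasDerivAt_duhamel (a : 𝔸) {h : ℝ → 𝔸} (hh : Continuous h) (t : ℝ) :
    HasDerivAt (duhamel a h) (a * duhamel a h t + h t) t := by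
  have hc : Continuous fun s : ℝ => NormedSpace.exp (-s • a) * h s :=
    ((continuous_exp_smul a).comp continuous_neg).mul hh
  have h1 := (hasDerivAt_exp_smul_const' (𝕂 := ℝ) a t).mul
    (intervalIntegral.integral_hasDerivAt_right (hc.intervalIntegrable 0 t)
      (hc.stronglyMeasurableAtFilter _ _) hc.continuousAt)
  refine h1.congr_deriv ?_
  rw [← mul_assoc, exp_smul_mul_exp_neg_smul, one_mul, duhamel, mul_assoc]

theorem continuous_duhamel (a : 𝔸) {h : ℝ → 𝔸} (hh : Continuous h) : Continuous (duhamel a h) :=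
  continuous_iff_continuousAt.2 fun t => (hasDerivAt_duhamel a hh t).continuousAt

/-- The integrating factor `exp (-t a)` turns the difference of two solutions into a constant. -/
theorem linear_ode_unique {a : 𝔸} {h u v : ℝ → 𝔸}
    (hu : ∀ t, HasDerivAt u (a * u t + h t) t) (hv : ∀ t, HasDerivAt v (a * v t + h t) t)
    (h0 : u 0 = v 0) : u = v := by
  have hd : ∀ t : ℝ,
      HasDerivAt (fun s : ℝ => NormedSpace.exp (-s • a) * (u s - v s)) 0 t := by
    intro t
    have h1 : HasDerivAt (fun s : ℝ => NormedSpace.exp (-s • a))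
        (-(NormedSpace.exp (-t • a) * a)) t := by
      have := (hasDerivAt_exp_smul_const (𝕂 := ℝ) a (-t)).scomp t (hasDerivAt_neg t)
      simpa [Function.comp_def] using this
    refine (h1.mul ((hu t).sub (hv t))).congr_deriv ?_
    simp only [Pi.sub_apply]
    noncomm_ring
  funext t
  have hconst := is_const_of_deriv_eq_zero (fun t => (hd t).differentiableAt)
    (fun t => (hd t).deriv) t 0
  simp only [h0, sub_self, mul_zero] at hconst
  have h2 := congrArg (fun x => NormedSpace.exp (t • a) * x) hconst
  simp only [← mul_assoc, exp_smul_mul_exp_neg_smul, one_mul, mul_zero] at h2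
  exact sub_eq_zero.1 h2

theorem duhamel_eq_integral (a : 𝔸) {h : ℝ → 𝔸} (hh : Continuous h) (t : ℝ) :
    duhamel a h t = ∫ s in (0 : ℝ)..t, NormedSpace.exp ((t - s) • a) * h s := by
  have hc : Continuous fun s : ℝ => NormedSpace.exp (-s • a) * h s :=
    ((continuous_exp_smul a).comp continuous_neg).mul hh
  rw [duhamel, ← ContinuousLinearMap.mul_apply' ℝ,
    ← ContinuousLinearMap.intervalIntegral_comp_comm _ (hc.intervalIntegrable 0 t)]
  simp only [ContinuousLinearMap.mul_apply', ← mul_assoc, ← exp_add_smul, sub_eq_add_neg]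

/-- Since `e^{(t-s)γ} e^{sγ} = e^{tγ}` does not depend on `s`, only `s^k / k!` is left to integrate.
Bounding products in `ha`, rather than `‖exp (s a)‖`, avoids assuming `‖1‖ = 1`. -/
theorem norm_duhamel_le {a : 𝔸} {h : ℝ → 𝔸} (hh : Continuous h) {γ K : ℝ} {k : ℕ}
    (ha : ∀ s : ℝ, 0 ≤ s → ∀ x : 𝔸, ‖NormedSpace.exp (s • a) * x‖ ≤ Real.exp (s * γ) * ‖x‖)
    {t : ℝ} (ht : 0 ≤ t)
    (hK : ∀ s : ℝ, 0 ≤ s → s ≤ t → ‖h s‖ ≤ K * Real.exp (s * γ) * (s ^ k / k !)) :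
    ‖duhamel a h t‖ ≤ K * Real.exp (t * γ) * (t ^ (k + 1) / (k + 1)!) := by
  rw [duhamel_eq_integral a hh]
  have hint : ∫ s in (0 : ℝ)..t, K * Real.exp (t * γ) * (s ^ k / k !) =
      K * Real.exp (t * γ) * (t ^ (k + 1) / (k + 1)!) := by
    rw [intervalIntegral.integral_const_mul, intervalIntegral.integral_div, integral_pow,
      Nat.factorial_succ]
    push_cast
    field_simp
    simp
  rw [← hint]
  refine intervalIntegral.norm_integral_le_of_norm_le ht (.of_forall fun s hs => ?_)
    (Continuous.intervalIntegrable (by fun_prop) _ _)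
  calc ‖NormedSpace.exp ((t - s) • a) * h s‖ ≤ Real.exp ((t - s) * γ) * ‖h s‖ :=
        ha _ (by linarith [hs.2]) _
    _ ≤ Real.exp ((t - s) * γ) * (K * Real.exp (s * γ) * (s ^ k / k !)) := by
        gcongr; exact hK s hs.1.le hs.2
    _ = K * (Real.exp ((t - s) * γ) * Real.exp (s * γ)) * (s ^ k / k !) := by ring
    _ = _ := by rw [← Real.exp_add]; ring_nf

/-! ### Divided differences of the exponential and Newton's identity. -/

theorem exp_smul_algebraMap_mul (w : ℂ) (s : ℝ) (x : 𝔸) :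
    NormedSpace.exp (s • algebraMap ℂ 𝔸 w) * x = Complex.exp (s * w) • x := by
  let : NormedAlgebra ℚ 𝔸 := NormedAlgebra.restrictScalars ℚ ℂ 𝔸
  have h1 : s • algebraMap ℂ 𝔸 w = algebraMap ℂ 𝔸 (s * w) := by
    rw [map_mul, ← Complex.coe_smul, Algebra.smul_def]
  rw [h1, ← NormedSpace.algebraMap_exp_comm, ← Algebra.smul_def, Complex.exp_eq_exp_ℂ]

theorem norm_exp_smul_algebraMap_mul_le {w : ℂ} {γ : ℝ} (hw : w.re ≤ γ) {s : ℝ} (hs : 0 ≤ s)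
    (x : 𝔸) : ‖NormedSpace.exp (s • algebraMap ℂ 𝔸 w) * x‖ ≤ Real.exp (s * γ) * ‖x‖ := by
  rw [exp_smul_algebraMap_mul, norm_smul, Complex.norm_exp]
  gcongr
  simpa using mul_le_mul_of_nonneg_left hw hs

/-- `expRemainder z a n t` is the divided difference of `x ↦ exp (t x)` at the points
`z 0, …, z (n - 1), a`. -/
noncomputable def expRemainder (z : ℕ → ℂ) (a : 𝔸) : ℕ → ℝ → 𝔸
  | 0 => fun t => NormedSpace.exp (t • a)
  | n + 1 => duhamel (algebraMap ℂ 𝔸 (z n)) (expRemainder z a n)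

/-- `expCoeff z n t` is the divided difference of `x ↦ exp (t x)` at the points `z 0, …, z n`. -/
noncomputable def expCoeff (z : ℕ → ℂ) : ℕ → ℝ → ℂ
  | 0 => fun t => Complex.exp (t * z 0)
  | n + 1 => duhamel (z (n + 1)) (expCoeff z n)

theorem continuous_expRemainder (z : ℕ → ℂ) (a : 𝔸) : ∀ n, Continuous (expRemainder z a n)
  | 0 => continuous_exp_smul a
  | n + 1 => continuous_duhamel _ (continuous_expRemainder z a n)

theorem continuous_expCoeff (z : ℕ → ℂ) : ∀ n, Continuous (expCoeff z n)
  | 0 => by unfold expCoeff; fun_prop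
  | n + 1 => continuous_duhamel _ (continuous_expCoeff z n)

theorem hasDerivAt_algebraMap_comp {f : ℝ → ℂ} {f' : ℂ} {t : ℝ} (hf : HasDerivAt f f' t) :
    HasDerivAt (fun s => algebraMap ℂ 𝔸 (f s)) (algebraMap ℂ 𝔸 f') t := by
  simpa only [Algebra.algebraMap_eq_smul_one] using hf.smul_const (1 : 𝔸)

/-- The recursion for divided differences, cleared of the denominator `a - z n`. Both sides solve
the same equation `y' = z n • y + h` with the same initial value, where `h` is the previous
coefficient, or `0` when `n = 0`. -/
theorem expRemainder_sub_eq_algebraMap (z : ℕ → ℂ) (a : 𝔸) (n : ℕ) :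
    (fun t => expRemainder z a n t - (a - algebraMap ℂ 𝔸 (z n)) * expRemainder z a (n + 1) t) =
      fun t => algebraMap ℂ 𝔸 (expCoeff z n t) := by
  induction n with
  | zero =>
    refine linear_ode_unique (a := algebraMap ℂ 𝔸 (z 0)) (h := fun _ => 0) (fun t => ?_)
      (fun t => ?_) ?_
    · refine ((hasDerivAt_exp_smul_const' (𝕂 := ℝ) a t).sub
        ((hasDerivAt_duhamel _ (continuous_expRemainder z a 0) t).const_mul _)).congr_deriv ?_
      simp only [expRemainder]
      have hc := (Algebra.commutes (z 0) a)
      simp only [mul_add, mul_sub, sub_mul, add_zero, ← mul_assoc, hc]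
      noncomm_ring
    · refine (hasDerivAt_algebraMap_comp (f' := z 0 * expCoeff z 0 t) ?_).congr_deriv
        (by simp)
      have := ((hasDerivAt_id t).ofReal_comp.mul_const (z 0)).cexp
      simpa [expCoeff, mul_comm] using this
    · simp [expRemainder, expCoeff, NormedSpace.exp_zero]
  | succ n ih =>
    refine linear_ode_unique (a := algebraMap ℂ 𝔸 (z (n + 1)))
      (h := fun t => algebraMap ℂ 𝔸 (expCoeff z n t)) (fun t => ?_) (fun t => ?_) ?_
    · refine ((hasDerivAt_duhamel _ (continuous_expRemainder z a n) t).sub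
        ((hasDerivAt_duhamel _ (continuous_expRemainder z a (n + 1)) t).const_mul _)).congr_deriv ?_
      rw [← congrFun ih t]
      simp only [expRemainder]
      have hc := (Algebra.commutes (z (n + 1)) a)
      simp only [mul_add, mul_sub, sub_mul, ← mul_assoc, hc]
      noncomm_ring
    · refine (hasDerivAt_algebraMap_comp
        (hasDerivAt_duhamel _ (continuous_expCoeff z n) t)).congr_deriv ?_
      simp [expCoeff]
    · simp [expRemainder, expCoeff]

/-- The Newton form of the interpolation polynomial of `x ↦ exp (t x)` at
`z 0, …, z (n - 1)`. -/
noncomputable def expNewton (z : ℕ → ℂ) (n : ℕ) (t : ℝ) : ℂ[X] :=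
  ∑ k ∈ Finset.range n, C (expCoeff z k t) * ∏ j ∈ Finset.range k, (X - C (z j))

theorem exp_smul_eq_aeval_expNewton_add (z : ℕ → ℂ) (a : 𝔸) (n : ℕ) (t : ℝ) :
    NormedSpace.exp (t • a) = aeval a (expNewton z n t) +
      aeval a (∏ j ∈ Finset.range n, (X - C (z j))) * expRemainder z a n t := by
  induction n with
  | zero => simp [expNewton, expRemainder]
  | succ n ih =>
    have h := congrFun (expRemainder_sub_eq_algebraMap z a n) t
    rw [sub_eq_iff_eq_add] at h
    rw [ih, h, expNewton, expNewton, Finset.sum_range_succ, Finset.prod_range_succ]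
    simp only [map_add, map_mul, aeval_C, map_sub, aeval_X]
    rw [Algebra.commutes (expCoeff z n t)]
    noncomm_ring

theorem degree_expNewton_lt (z : ℕ → ℂ) (n : ℕ) (t : ℝ) : (expNewton z n t).degree < n := by
  refine (degree_sum_le _ _).trans_lt ((Finset.sup_lt_iff (WithBot.bot_lt_coe n)).2 fun k hk => ?_)
  refine (degree_mul_le _ _).trans_lt ?_
  have h1 : (∏ j ∈ Finset.range k, (X - C (z j)) : ℂ[X]).degree = (k : WithBot ℕ) := by
    simp [degree_prod]
  rw [h1]
  calc (C (expCoeff z k t)).degree + (k : WithBot ℕ) ≤ 0 + k := by gcongr; exact degree_C_le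
    _ = k := zero_add _
    _ < n := by exact_mod_cast Finset.mem_range.1 hk

theorem norm_expRemainder_le {z : ℕ → ℂ} {a : 𝔸} {γ K : ℝ} {n : ℕ}
    (hz : ∀ k < n, (z k).re ≤ γ)
    (ha : ∀ t : ℝ, 0 ≤ t → t ≤ 1 → ‖NormedSpace.exp (t • a)‖ ≤ K * Real.exp (t * γ))
    {t : ℝ} (ht : 0 ≤ t) (ht1 : t ≤ 1) :
    ‖expRemainder z a n t‖ ≤ K * Real.exp (t * γ) * (t ^ n / n !) := by
  induction n generalizing t with
  | zero => simpa [expRemainder] using ha t ht ht1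
  | succ n ih =>
    exact norm_duhamel_le (continuous_expRemainder z a n)
      (fun s hs x => norm_exp_smul_algebraMap_mul_le (hz n n.lt_succ_self) hs x) ht
      fun s hs hst => ih (fun k hk => hz k (hk.trans n.lt_succ_self)) hs (hst.trans ht1)

end Duhamel

/-! ### Uniqueness of Hermite interpolation. -/

section Interpolation

open Filter Topology Asymptotics

/-- Were the multiplicity smaller, dividing it out would leave a cofactor tending to `0` at `w`,
hence vanishing there. -/
theorem le_rootMultiplicity_of_isBigO {q : ℂ[X]} (hq : q ≠ 0) {w : ℂ} {r : ℕ}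
    (h : (fun x => q.eval x) =O[𝓝 w] fun x => (x - w) ^ r) : r ≤ q.rootMultiplicity w := by
  by_contra! hlt
  obtain ⟨u, hu, hdvd⟩ := exists_eq_pow_rootMultiplicity_mul_and_not_dvd q hq w
  set s := q.rootMultiplicity w
  obtain ⟨d, hd⟩ := Nat.exists_eq_add_of_lt hlt
  have h1 : (fun x => u.eval x) =O[𝓝[≠] w] fun x => (x - w) ^ (d + 1) := by
    have h2 := (isBigO_refl (fun x : ℂ => ((x - w) ^ s)⁻¹) (𝓝[≠] w)).mul
      (h.mono nhdsWithin_le_nhds)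
    refine h2.congr' ?_ ?_ <;> filter_upwards [self_mem_nhdsWithin] with x hx
    · have : x - w ≠ 0 := sub_ne_zero.2 hx
      rw [hu]
      simp [inv_mul_cancel_left₀ (pow_ne_zero s this)]
    · have : x - w ≠ 0 := sub_ne_zero.2 hx
      rw [hd, add_assoc, pow_add, inv_mul_cancel_left₀ (pow_ne_zero s this)]
  have h3 : Tendsto (fun x : ℂ => (x - w) ^ (d + 1)) (𝓝[≠] w) (𝓝 0) := by
    have : Continuous fun x : ℂ => (x - w) ^ (d + 1) := by fun_prop
    simpa using (this.tendsto w).mono_left nhdsWithin_le_nhds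
  have h4 := tendsto_nhds_unique (h1.trans_tendsto h3)
    ((u.continuous.tendsto w).mono_left nhdsWithin_le_nhds)
  exact hdvd (dvd_iff_isRoot.2 h4.symm)

theorem iteratedDeriv_eval (p : ℂ[X]) (j : ℕ) :
    iteratedDeriv j (fun x => p.eval x) = fun x => (derivative^[j] p).eval x := by
  induction j with
  | zero => simp
  | succ j ih =>
    rw [iteratedDeriv_succ, ih, Function.iterate_succ_apply']
    funext x
    exact Polynomial.deriv _

theorem isBigO_sub_eval_of_iteratedDeriv_eq {f : ℂ → ℂ} (hf : ∀ x, AnalyticAt ℂ f x) {p : ℂ[X]}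
    {w : ℂ} {r : ℕ}
    (h : ∀ j < r, (derivative^[j] p).eval w = iteratedDeriv j f w) :
    (fun x => f x - p.eval x) =O[𝓝 w] fun x => (x - w) ^ r := by
  have hp : AnalyticAt ℂ (fun x => p.eval x) w := by
    simpa using analyticAt_id.aeval_polynomial (z := w) p
  have hF : AnalyticAt ℂ (fun x => f x - p.eval x) w := (hf w).sub hp
  have hord : (r : ℕ∞) ≤ analyticOrderAt (fun x => f x - p.eval x) w := by
    rw [natCast_le_analyticOrderAt_iff_iteratedDeriv_eq_zero hF]
    intro j hj
    rw [iteratedDeriv_fun_sub (hf w).contDiffAt hp.contDiffAt, iteratedDeriv_eval,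
      ← h j hj, sub_self]
  obtain ⟨g, hg, he⟩ := (natCast_le_analyticOrderAt hF).1 hord
  refine IsBigO.congr' ?_ (EventuallyEq.symm he) .rfl
  simpa using (isBigO_refl (fun x : ℂ => (x - w) ^ r) (𝓝 w)).mul
    (hg.continuousAt.isBigO_one ℂ)

theorem pow_ncard_dvd_nodePolynomial {n : ℕ} (z : Fin n → ℂ) (w : ℂ) :
    (X - C w) ^ {k : Fin n | z k = w}.ncard ∣ nodePolynomial z := by
  classical
  have h1 : {k : Fin n | z k = w} = (Finset.univ.filter fun k => z k = w : Finset (Fin n)) := by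
    ext; simp
  rw [h1, Set.ncard_coe_finset, nodePolynomial,
    ← Finset.prod_filter_mul_prod_filter_not Finset.univ fun k => z k = w]
  refine Dvd.intro _ (congrArg (· * _) ?_)
  symm
  exact Finset.prod_eq_pow_card fun k hk => by rw [(Finset.mem_filter.1 hk).2]

/-- The extension of a finite sequence by zero. -/
def extendNodes {n : ℕ} (z : Fin n → ℂ) (k : ℕ) : ℂ :=
  if h : k < n then z ⟨k, h⟩ else 0

theorem extendNodes_of_lt {n : ℕ} (z : Fin n → ℂ) {k : ℕ} (h : k < n) :
    extendNodes z k = z ⟨k, h⟩ := dif_pos h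

theorem prod_extendNodes {n : ℕ} (z : Fin n → ℂ) :
    ∏ j ∈ Finset.range n, (X - C (extendNodes z j)) = nodePolynomial z := by
  rw [Finset.prod_range, nodePolynomial]
  simp [extendNodes_of_lt]

theorem extendNodes_re_le {n : ℕ} (z : Fin n → ℂ) (k : ℕ) (hk : k < n) :
    (extendNodes z k).re ≤ nodeAbscissa z := by
  rw [extendNodes_of_lt z hk]
  exact le_ciSup (f := fun k => (z k).re) (Set.finite_range _).bddAbove _

/-- Newton's identity in the algebra `ℂ` itself: `Ω` supplies the power of `x - w`, and the
remainder is locally bounded. -/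
theorem isBigO_exp_sub_expNewton {n : ℕ} (z : Fin n → ℂ) (w : ℂ) :
    (fun x => Complex.exp x - (expNewton (extendNodes z) n 1).eval x) =O[𝓝 w]
      fun x => (x - w) ^ {k : Fin n | z k = w}.ncard := by
  obtain ⟨R, hR⟩ := pow_ncard_dvd_nodePolynomial z w
  have hg : (fun x : ℂ => expRemainder (extendNodes z) x n 1) =O[𝓝 w] fun _ => (1 : ℂ) := by
    -- The exponent must dominate the real parts of the nodes and of every `x` near `w`; there `x.re
    -- < w.re + 1`.
    refine IsBigO.of_bound
      (1 * Real.exp (1 * max (nodeAbscissa z) (w.re + 1)) * (1 ^ n / n !)) ?_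
    filter_upwards [Complex.continuous_re.continuousAt.eventually_lt_const (lt_add_one w.re)]
      with x hx
    rw [norm_one, mul_one]
    refine norm_expRemainder_le
      (fun k hk => (extendNodes_re_le z k hk).trans (le_max_left _ _)) (fun t ht _ => ?_)
      zero_le_one le_rfl
    rw [← Complex.exp_eq_exp_ℂ, Complex.norm_exp, one_mul]
    gcongr
    simpa using mul_le_mul_of_nonneg_left (hx.le.trans (le_max_right _ _)) ht
  have h1 : ∀ x, Complex.exp x - (expNewton (extendNodes z) n 1).eval x =
      (x - w) ^ {k : Fin n | z k = w}.ncard * (R.eval x * expRemainder (extendNodes z) x n 1) := by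
    intro x
    have h := exp_smul_eq_aeval_expNewton_add (extendNodes z) x n 1
    rw [one_smul, ← Complex.exp_eq_exp_ℂ, prod_extendNodes, hR] at h
    rw [h]
    simp [mul_assoc]
  simp only [h1]
  simpa using (isBigO_refl (fun x : ℂ => (x - w) ^ {k : Fin n | z k = w}.ncard) (𝓝 w)).mul
    ((R.continuous.continuousAt.isBigO_one ℂ).mul hg)

/-- Otherwise the `n` nodes, with multiplicity, would all be among fewer than `n` roots. -/
theorem eq_zero_of_forall_isBigO {n : ℕ} {z : Fin n → ℂ} {q : ℂ[X]} (hdeg : q.degree < n)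
    (h : ∀ w, (fun x => q.eval x) =O[𝓝 w] fun x => (x - w) ^ {k : Fin n | z k = w}.ncard) :
    q = 0 := by
  classical
  by_contra hq
  have hle : Finset.univ.val.map z ≤ q.roots := by
    rw [Multiset.le_iff_count]
    intro w
    rw [count_roots, Multiset.count_map]
    refine le_trans (le_of_eq ?_) (le_rootMultiplicity_of_isBigO hq (h w))
    rw [← Finset.filter_val, Finset.card_val, ← Set.ncard_coe_finset]
    simp [eq_comm]
  have h1 := (Multiset.card_le_card hle).trans (card_roots' q)
  rw [Multiset.card_map, Finset.card_val, Finset.card_univ, Fintype.card_fin] at h1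
  exact absurd ((natDegree_lt_iff_degree_lt hq).2 hdeg) h1.not_gt

theorem IsInterpolationPolynomial.eq_expNewton {n : ℕ} {z : Fin n → ℂ} {p : ℂ[X]}
    (hp : IsInterpolationPolynomial Complex.exp z p) : p = expNewton (extendNodes z) n 1 := by
  refine sub_eq_zero.1 (eq_zero_of_forall_isBigO (z := z)
    ((degree_sub_le _ _).trans_lt (max_lt hp.1 (degree_expNewton_lt _ _ _))) fun w => ?_)
  have h1 := (isBigO_exp_sub_expNewton z w).sub
    (isBigO_sub_eval_of_iteratedDeriv_eq (fun x => by fun_prop) (hp.2 w))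
  simpa using h1

end Interpolation

/-! ### The exponential of a triangular matrix. -/

section Triangular

variable {m : ℕ}

/-- The terms of the Dyson series of `exp (t (D + N))`. -/
noncomputable def dysonTerm (D N : Matrix (Fin m) (Fin m) ℂ) : ℕ → ℝ → Matrix (Fin m) (Fin m) ℂ
  | 0 => fun t => NormedSpace.exp (t • D)
  | j + 1 => duhamel D fun t => N * dysonTerm D N j t

theorem continuous_dysonTerm (D N : Matrix (Fin m) (Fin m) ℂ) : ∀ j, Continuous (dysonTerm D N j)
  | 0 => continuous_exp_smul D
  | j + 1 => continuous_duhamel _ (continuous_const.mul (continuous_dysonTerm D N j))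

/-- Summing the equations of the terms gives `y' = (D + N) y`, up to `N` times the last term. -/
theorem exp_smul_eq_sum_dysonTerm {D N : Matrix (Fin m) (Fin m) ℂ} {k : ℕ}
    (hk : dysonTerm D N k = 0) (t : ℝ) :
    NormedSpace.exp (t • (D + N)) = ∑ j ∈ Finset.range k, dysonTerm D N j t := by
  rcases k with _ | k
  · have h1 := congrFun hk 0
    simp only [dysonTerm, zero_smul, NormedSpace.exp_zero, Pi.zero_apply] at h1
    have : Subsingleton (Matrix (Fin m) (Fin m) ℂ) := subsingleton_of_zero_eq_one h1.symm
    exact Subsingleton.elim _ _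
  have hd : ∀ j t, HasDerivAt (dysonTerm D N (j + 1))
      (D * dysonTerm D N (j + 1) t + N * dysonTerm D N j t) t := fun j t =>
    hasDerivAt_duhamel D (continuous_const.mul (continuous_dysonTerm D N j)) t
  -- This is the forcing term in the equation of the next Dyson term, which is identically zero.
  have hlast : ∀ t, N * dysonTerm D N k t = 0 := by
    intro t
    have h1 := hd k t
    rw [hk] at h1
    simpa using h1.unique (hasDerivAt_const t 0)
  refine congrFun (linear_ode_unique (a := D + N) (h := fun _ => 0)
    (u := fun t => NormedSpace.exp (t • (D + N)))
    (v := fun t => ∑ j ∈ Finset.range (k + 1), dysonTerm D N j t)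
    (fun t => ?_) (fun t => ?_) ?_) t
  · simpa using hasDerivAt_exp_smul_const' (𝕂 := ℝ) (D + N) t
  · have h0 : HasDerivAt (dysonTerm D N 0) (D * dysonTerm D N 0 t) t :=
      hasDerivAt_exp_smul_const' (𝕂 := ℝ) D t
    have h1 := (HasDerivAt.fun_sum fun j (_ : j ∈ Finset.range k) => hd j t).add h0
    have h2 : (fun t => ∑ j ∈ Finset.range (k + 1), dysonTerm D N j t) =
        (fun t => ∑ j ∈ Finset.range k, dysonTerm D N (j + 1) t) + dysonTerm D N 0 := by
      funext t
      simp [Finset.sum_range_succ']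
    rw [h2]
    refine h1.congr_deriv ?_
    rw [add_mul, Finset.mul_sum, Finset.sum_range_succ', Finset.mul_sum,
      Finset.sum_range_succ (fun j => N * dysonTerm D N j t), hlast,
      Finset.sum_add_distrib]
    abel
  · simp [Finset.sum_range_succ', dysonTerm, NormedSpace.exp_zero]

theorem exp_smul_diagonal (d : Fin m → ℂ) (t : ℝ) :
    NormedSpace.exp (t • Matrix.diagonal d) = Matrix.diagonal fun i => Complex.exp (t * d i) := by
  have h1 : t • Matrix.diagonal d = Matrix.diagonal fun i => (t : ℂ) * d i := by
    ext i j
    by_cases h : i = j <;> simp [h, Matrix.diagonal]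
  rw [h1, Matrix.exp_diagonal, Pi.exp_def]
  simp [Complex.exp_eq_exp_ℂ]

theorem norm_exp_smul_diagonal_le {d : Fin m → ℂ} {γ : ℝ} (hd : ∀ i, (d i).re ≤ γ) {t : ℝ}
    (ht : 0 ≤ t) : ‖NormedSpace.exp (t • Matrix.diagonal d)‖ ≤ Real.exp (t * γ) := by
  rw [exp_smul_diagonal, Matrix.l2_opNorm_diagonal, pi_norm_le_iff_of_nonneg (Real.exp_pos _).le]
  intro i
  rw [Complex.norm_exp]
  gcongr
  simpa using mul_le_mul_of_nonneg_left (hd i) ht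

theorem norm_dysonTerm_le {d : Fin m → ℂ} (N : Matrix (Fin m) (Fin m) ℂ) {γ : ℝ}
    (hd : ∀ i, (d i).re ≤ γ) (j : ℕ) {t : ℝ} (ht : 0 ≤ t) :
    ‖dysonTerm (Matrix.diagonal d) N j t‖ ≤ ‖N‖ ^ j * Real.exp (t * γ) * (t ^ j / j !) := by
  induction j generalizing t with
  | zero => simpa [dysonTerm] using norm_exp_smul_diagonal_le hd ht
  | succ j ih =>
    refine norm_duhamel_le (continuous_const.mul (continuous_dysonTerm _ N j))
      (fun s hs x => ?_) ht fun s hs _ => ?_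
    · exact (norm_mul_le _ _).trans (by gcongr; exact norm_exp_smul_diagonal_le hd hs)
    · calc ‖N * dysonTerm (Matrix.diagonal d) N j s‖
          ≤ ‖N‖ * (‖N‖ ^ j * Real.exp (s * γ) * (s ^ j / j !)) :=
            (norm_mul_le _ _).trans (by gcongr; exact ih hs)
        _ = _ := by ring

theorem intervalIntegral_matrix_apply {f : ℝ → Matrix (Fin m) (Fin m) ℂ} (hf : Continuous f)
    (a b : ℝ) (i k : Fin m) : (∫ s in a..b, f s) i k = ∫ s in a..b, f s i k :=
  (((Matrix.entryLinearMap ℝ ℂ i k).toContinuousLinearMap).intervalIntegral_comp_comm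
    (hf.intervalIntegrable a b)).symm

/-- Each factor `N` raises the rank `ρ` by at least one, while diagonal exponentials preserve it. A
general `ρ` covers upper (`ρ i = i`) and lower (`ρ i = -i`) triangular matrices together; ranks
there differ by less than `m`, so order `m` vanishes. -/
theorem dysonTerm_apply_eq_zero {d : Fin m → ℂ} {N : Matrix (Fin m) (Fin m) ℂ} {ρ : Fin m → ℤ}
    (hN : ∀ i k, ρ k ≤ ρ i → N i k = 0) (j : ℕ) (t : ℝ) {i k : Fin m} (hik : ρ k < ρ i + j) :
    dysonTerm (Matrix.diagonal d) N j t i k = 0 := by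
  induction j generalizing t i k with
  | zero =>
    have hne : i ≠ k := by rintro rfl; simp at hik
    simp only [dysonTerm, exp_smul_diagonal]
    exact Matrix.diagonal_apply_ne _ hne
  | succ j ih =>
    have hc : Continuous fun s : ℝ => NormedSpace.exp (-s • Matrix.diagonal d) *
        (N * dysonTerm (Matrix.diagonal d) N j s) :=
      ((continuous_exp_smul _).comp continuous_neg).mul
        (continuous_const.mul (continuous_dysonTerm _ N j))
    simp only [dysonTerm, duhamel]
    rw [exp_smul_diagonal, Matrix.diagonal_mul, intervalIntegral_matrix_apply hc,
      intervalIntegral.integral_congr (g := fun _ => 0), intervalIntegral.integral_zero, mul_zero]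
    intro s _
    simp only
    rw [exp_smul_diagonal, Matrix.diagonal_mul, Matrix.mul_apply, Finset.sum_eq_zero, mul_zero]
    intro l _
    by_cases hl : ρ l ≤ ρ i
    · rw [hN i l hl, zero_mul]
    · rw [ih s (by push_cast at hik; omega), mul_zero]

theorem dysonTerm_eq_zero (d : Fin m → ℂ) {N : Matrix (Fin m) (Fin m) ℂ}
    (hN : IsStrictlyTriangular N) : dysonTerm (Matrix.diagonal d) N m = 0 := by
  funext t
  ext i k
  rcases hN with hN | hN
  · exact dysonTerm_apply_eq_zero (ρ := fun i => (i : ℤ))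
      (fun i k h => hN i k (by exact_mod_cast h)) m t (by have := k.2; omega)
  · exact dysonTerm_apply_eq_zero (ρ := fun i => -(i : ℤ))
      (fun i k h => hN i k (by exact_mod_cast neg_le_neg_iff.1 h)) m t (by have := i.2; omega)

theorem norm_exp_smul_diagonal_add_le {d : Fin m → ℂ} {N : Matrix (Fin m) (Fin m) ℂ}
    (hN : IsStrictlyTriangular N) {γ : ℝ} (hd : ∀ i, (d i).re ≤ γ) {t : ℝ} (ht : 0 ≤ t)
    (ht1 : t ≤ 1) : ‖NormedSpace.exp (t • (Matrix.diagonal d + N))‖ ≤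
      (∑ j ∈ Finset.range m, ‖N‖ ^ j / (j ! : ℝ)) * Real.exp (t * γ) := by
  rw [exp_smul_eq_sum_dysonTerm (dysonTerm_eq_zero d hN), Finset.sum_mul]
  refine norm_sum_le_of_le _ fun j _ => (norm_dysonTerm_le N hd j ht).trans ?_
  calc ‖N‖ ^ j * Real.exp (t * γ) * (t ^ j / j !)
      ≤ ‖N‖ ^ j * Real.exp (t * γ) * (1 / j !) := by gcongr; exact pow_le_one₀ ht ht1
    _ = _ := by ring

theorem diagonal_mem_spectrum (d : Fin m → ℂ) {N : Matrix (Fin m) (Fin m) ℂ}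
    (hN : IsStrictlyTriangular N) (i : Fin m) : d i ∈ spectrum ℂ (Matrix.diagonal d + N) := by
  have hdiag : ∀ k, N k k = 0 := fun k => hN.elim (fun h => h k k le_rfl) fun h => h k k le_rfl
  rw [spectrum.mem_iff, Matrix.isUnit_iff_isUnit_det, isUnit_iff_ne_zero, not_not]
  have hprod : (algebraMap ℂ (Matrix (Fin m) (Fin m) ℂ) (d i) - (Matrix.diagonal d + N)).det =
      ∏ k, (algebraMap ℂ (Matrix (Fin m) (Fin m) ℂ) (d i) - (Matrix.diagonal d + N)) k k := by
    rcases hN with hN | hN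
    · refine Matrix.det_of_isUpperTriangular fun a b hab => ?_
      have hab : b < a := hab
      simp [Matrix.algebraMap_matrix_apply, hN a b hab.le, hab.ne', Matrix.diagonal_apply_ne]
    · refine Matrix.det_of_isLowerTriangular _ fun a b hab => ?_
      have hab : a < b := hab
      simp [Matrix.algebraMap_matrix_apply, hN a b hab.le, hab.ne, Matrix.diagonal_apply_ne]
  rw [hprod]
  exact Finset.prod_eq_zero (Finset.mem_univ i) (by simp [Matrix.algebraMap_matrix_apply, hdiag])

end Triangular

/-! ### Unitary invariance and the final estimate. -/

theorem norm_unitary_conj {m : ℕ} {Q : Matrix (Fin m) (Fin m) ℂ}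
    (hQ : Q ∈ Matrix.unitaryGroup (Fin m) ℂ) (M : Matrix (Fin m) (Fin m) ℂ) :
    ‖Q⁻¹ * M * Q‖ = ‖M‖ := by
  have hinv : Q⁻¹ = star Q := Matrix.inv_eq_left_inv (Matrix.mem_unitaryGroup_iff'.1 hQ)
  rw [hinv, CStarRing.norm_mul_mem_unitary _ hQ,
    CStarRing.norm_mem_unitary_mul _ (Unitary.star_mem hQ)]

theorem corollary5 {m n : ℕ} (hm : 0 < m) (hn : 0 < n)
    (A Q D N : Matrix (Fin m) (Fin m) ℂ)
    (hQ : Q ∈ Matrix.unitaryGroup (Fin m) ℂ)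
    (hD : D.IsDiag) (hN : IsStrictlyTriangular N)
    (hA : A = Q⁻¹ * (D + N) * Q)
    (z : Fin n → ℂ) (p : ℂ[X])
    (hp : IsInterpolationPolynomial Complex.exp z p) :
    ‖NormedSpace.exp A - aeval A p‖ ≤
      Real.exp (max (spectralAbscissa A) (nodeAbscissa z)) *
        (‖aeval A (nodePolynomial z)‖ / (n ! : ℝ)) *
          ∑ j ∈ Finset.range m, ‖N‖ ^ j / (j ! : ℝ) := by
  obtain ⟨d, rfl⟩ : ∃ d, D = Matrix.diagonal d := ⟨_, hD.diagonal_diag.symm⟩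
  have hunit : IsUnit Q := (Unitary.toUnits ⟨Q, hQ⟩).isUnit
  have hspec : spectrum ℂ A = spectrum ℂ (Matrix.diagonal d + N) := by
    obtain ⟨u, rfl⟩ := hunit
    rw [hA, ← Matrix.coe_units_inv]
    exact spectrum.units_conjugate'
  have hd : ∀ i, (d i).re ≤ max (spectralAbscissa A) (nodeAbscissa z) := fun i =>
    le_max_of_le_left <| le_csSup ((Matrix.finite_spectrum A).image _).bddAbove
      ⟨d i, hspec ▸ diagonal_mem_spectrum d hN i, rfl⟩
  -- The whole interval is needed because the remainder integrates `exp (t A)` over `[0, 1]`; `t ≤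
  -- 1` lets the constant be independent of `t`.
  have hexp : ∀ t : ℝ, 0 ≤ t → t ≤ 1 → ‖NormedSpace.exp (t • A)‖ ≤
      (∑ j ∈ Finset.range m, ‖N‖ ^ j / (j ! : ℝ)) *
        Real.exp (t * max (spectralAbscissa A) (nodeAbscissa z)) := by
    intro t ht ht1
    have h1 : t • A = Q⁻¹ * (t • (Matrix.diagonal d + N)) * Q := by
      rw [hA, mul_smul_comm, smul_mul_assoc]
    rw [h1, Matrix.exp_conj' _ _ hunit, norm_unitary_conj hQ]
    exact norm_exp_smul_diagonal_add_le hN hd ht ht1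
  have hrem := norm_expRemainder_le (z := extendNodes z) (n := n)
    (fun k hk => (extendNodes_re_le z k hk).trans (le_max_right _ _)) hexp zero_le_one le_rfl
  have hsplit := exp_smul_eq_aeval_expNewton_add (extendNodes z) A n 1
  rw [one_smul, prod_extendNodes, ← hp.eq_expNewton] at hsplit
  rw [hsplit, add_sub_cancel_left]
  calc ‖aeval A (nodePolynomial z) * expRemainder (extendNodes z) A n 1‖
      ≤ ‖aeval A (nodePolynomial z)‖ * ‖expRemainder (extendNodes z) A n 1‖ := norm_mul_le _ _
    _ ≤ _ := mul_le_mul_of_nonneg_left hrem (norm_nonneg _)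
    _ = _ := by rw [one_mul, one_pow]; ring
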